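/- For a finite set $X\subset\mathbb R^2$ and an integer $m\ge 1$ with $|X|\ge m$, let $$\mathrm{OPT}^{(m)}(X)=\min_{c\in\mathbb R^2}\ \min_{Y\subseteq X,\ |Y|=m}\ \sum_{x\in X\setminus Y}\|x-c\|_2$$ be the optimal value of $(1,m)$-Median on $X$ (1-median with $m$ outliers); if $|X|<m$, put $\mathrm{OPT}^{(m)}(X)=0$. A number $g>0$ is an $m$-approximation to this value if $\mathrm{OPT}^{(m)}(X)/m\le g\le m\cdot \mathrm{OPT}^{(m)}(X)$. For every constant $p\in(1/2,1]$ there is a constant $c>0$, depending only on $p$, such that the following holds for every integer $m\ge 10$. Let $\mathcal A$ be a randomized one-pass streaming algorithm that, for every dataset $X\subseteq[2m^{10}]^2=\{1,\dots,2m^{10}\}^2$ with $\mathrm{OPT}^{(m)}(X)>0$ whose points are presented one by one, in any order, as an insertion-only stream, outputs with probability at least $p$ an $m$-approximation $g>0$ to $\mathrm{OPT}^{(m)}(X)$. Then $\mathcal A$ uses at least $c\,m$ bits of space (memory kept between insertions); that is, any such algorithm must use space $\Omega(m)$. -/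

import Mathlib

open MeasureTheory

universe u

/-! ### `(k,m)`-Median: `k`-median clustering with `m` outliers -/

noncomputable section

open Classical in
/-- The `k`-median cost of a finite dataset `X` for the center set `C`: the sum over `x ∈ X` of
`dist (x, C) = min_{c ∈ C} dist (x, c)`. -/
def medianCost {V : Type*} [MetricSpace V] (X C : Finset V) : ℝ :=
  ∑ x ∈ X, Metric.infDist x (C : Set V)

open Classical in
/-- The cost with `m` outliers: the minimum of the cost of `X \ Y` over all `m`-point subsets `Y`
of `X` (and `0` when `X` has fewer than `m` points). -/
def outlierCost {V : Type*} [MetricSpace V] (m : ℕ) (X C : Finset V) : ℝ :=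
  ⨅ Y : {Y : Finset V // Y ∈ X.powersetCard m}, medianCost (X \ Y.1) C

/-- The optimal objective value of `(k,m)`-Median on `X`: the infimum of the cost with `m` outliers
over all sets of `k` centers in the ambient metric space `V`. -/
def medianOpt {V : Type*} [MetricSpace V] (k m : ℕ) (X : Finset V) : ℝ :=
  ⨅ C : {C : Finset V // C.card = k}, outlierCost m X C.1

/-- `g > 0` is an `α`-approximation (within a factor `α`, in either direction) to the value `v`. -/
def IsApproxValue (α v g : ℝ) : Prop :=
  0 < g ∧ v / α ≤ g ∧ g ≤ α * v

/-! ### The discrete grid `[Δ]^d` in Euclidean space -/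

/-- Points of the grid `[Δ]^d = {1, …, Δ}^d`. -/
abbrev GridPoint (Δ d : ℕ) : Type := Fin d → Set.Icc (1 : ℕ) Δ

/-- A grid point as a point of `ℝ^d` with the Euclidean metric. -/
def GridPoint.toEuclidean {Δ d : ℕ} (x : GridPoint Δ d) : EuclideanSpace ℝ (Fin d) :=
  WithLp.toLp 2 fun i => ((x i : ℕ) : ℝ)

open Classical in
/-- The dataset in `ℝ^d` whose points are inserted by a stream of grid points. -/
def streamDataset {Δ d : ℕ} (L : List (GridPoint Δ d)) : Finset (EuclideanSpace ℝ (Fin d)) :=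
  (L.map GridPoint.toEuclidean).toFinset

/-! ### Randomized streaming algorithms -/

/-- A one-pass randomized streaming algorithm that reads a stream of insertions of elements of `T`
and has `space` bits of memory, whose content is all that it keeps from one insertion to the next.
It outputs a real number at the end of the stream.

Computation between insertions is unrestricted and is not charged. The random source `Ω` and the
number `t` of insertions made so far can be read for free as well (so that fresh coins may be used
at every step); this only makes the class of algorithms larger. -/
structure StreamingAlgorithm (T : Type) where
  /-- number of bits of memory -/
  space : ℕ
  /-- the sample space of the random source -/
  Ω : Type u
  /-- the events -/
  mΩ : MeasurableSpace Ω
  /-- the law of the random source -/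
  law : Measure Ω
  isProbabilityMeasure : IsProbabilityMeasure law
  /-- content of the memory before the first insertion -/
  init : Ω → (Fin space → Bool)
  /-- new content of the memory when `x : T` is inserted after `t` earlier insertions -/
  step : Ω → (t : ℕ) → (Fin space → Bool) → (x : T) → (Fin space → Bool)
  /-- answer at the end of a stream of `t` insertions -/
  output : Ω → (t : ℕ) → (Fin space → Bool) → ℝ
  measurable_init : Measurable init
  measurable_step : ∀ t σ x, Measurable fun ω => step ω t σ x
  measurable_output : ∀ t σ, Measurable fun ω => output ω t σ

namespace StreamingAlgorithm

/-- Content of the memory after the insertions in `L`, if it was `σ` after the first `t`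
insertions. -/
def stateFrom {T : Type} (A : StreamingAlgorithm.{u} T) (ω : A.Ω) :
    ℕ → (Fin A.space → Bool) → List T → (Fin A.space → Bool)
  | _, σ, [] => σ
  | t, σ, x :: L => stateFrom A ω (t + 1) (A.step ω t σ x) L

/-- The answer of the algorithm on the stream `L` with random source `ω`. -/
def answer {T : Type} (A : StreamingAlgorithm.{u} T) (L : List T) (ω : A.Ω) : ℝ :=
  A.output ω L.length (A.stateFrom ω 0 (A.init ω) L)

/-- The probability that the answer on the stream `L` satisfies `P`. -/
def probAnswer {T : Type} (A : StreamingAlgorithm.{u} T) (L : List T) (P : ℝ → Prop) : ℝ :=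
  letI := A.mΩ
  A.law.real {ω | P (A.answer L ω)}

/-- With probability at least `p`, the algorithm outputs an `α`-approximation to the optimal value
of `(k,m)`-Median, for every dataset `X ⊆ [Δ]^d` with positive optimal value that is presented, in
any order, as a stream of insertions of its points. (For a dataset with optimal value `0` no
positive number is an approximation in the multiplicative sense; nothing is asked there.) -/
def ApproximatesMedian {Δ d : ℕ} (A : StreamingAlgorithm.{u} (GridPoint Δ d))
    (k m : ℕ) (α p : ℝ) : Prop :=
  ∀ L : List (GridPoint Δ d), L.Nodup → 0 < medianOpt k m (streamDataset L) →
    p ≤ A.probAnswer L (IsApproxValue α (medianOpt k m (streamDataset L)))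

end StreamingAlgorithm

end

/-! The reduction is from the one-way index problem. A string of `m + 1` bits becomes `m + 1`
far-apart points, one per column, the bit choosing between two heights; a query for index `i`
inserts one point next to the `false` position of column `i`. Of the resulting `m + 2` points all
but two are discarded, and two points have 1-median cost equal to their distance, so the optimum is
the least pairwise distance (`le_medianOpt_one`, `medianOpt_one_le`): 1 if the bit is `false`, at
least `K = m ^ 3` otherwise. An `m`-approximation tells these apart, so the memory before the query
is a message from which every bit can be guessed with advantage `2 * p - 1`. By
`index_message_length` such a message has linear length. -/

/-! ### One-way communication bound for the index problem -/

/-- `1` if the bits agree, `-1` otherwise. -/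
def agreementSign (a b : Bool) : ℝ := if a = b then 1 else -1

/-- For a fixed guess `y` and uniform `x` the agreement signs are independent fair signs, so the
exponential moment factors over coordinates. -/
theorem sum_exp_agreement {n : ℕ} (d : ℝ) (y : Fin n → Bool) :
    ∑ x : Fin n → Bool, Real.exp (d * ∑ i, agreementSign (x i) (y i)) =
      2 ^ n * Real.cosh d ^ n := by
  have h (i : Fin n) :
      ∑ b : Bool, Real.exp (d * agreementSign b (y i)) = 2 * Real.cosh d := by
    rw [Real.cosh_eq]
    cases y i <;> simp [agreementSign] <;> ring
  calc ∑ x : Fin n → Bool, Real.exp (d * ∑ i, agreementSign (x i) (y i))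
      = ∑ x : Fin n → Bool, ∏ i, Real.exp (d * agreementSign (x i) (y i)) := by
        simp_rw [Finset.mul_sum, Real.exp_sum]
    _ = ∏ i : Fin n, ∑ b : Bool, Real.exp (d * agreementSign b (y i)) := by
        rw [Finset.prod_univ_sum, Fintype.piFinset_univ]
    _ = 2 ^ n * Real.cosh d ^ n := by
        simp_rw [h]
        simp [mul_pow]

/-- If `n` random bits are recovered from an `s`-bit message with average advantage `d` per bit,
then `s ≥ n d² / 2`. -/
theorem index_message_length {n s : ℕ} {d : ℝ} (hd : 0 ≤ d)
    (M : (Fin n → Bool) → (Fin s → Bool)) (D : (Fin s → Bool) → Fin n → Bool)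
    (h : d * (2 ^ n * n) ≤ ∑ x, ∑ i, agreementSign (x i) (D (M x) i)) :
    d ^ 2 / 2 * n ≤ s := by
  have hN : (0 : ℝ) < 2 ^ n := by positivity
  have jensen : Real.exp (∑ x : Fin n → Bool, (2 ^ n : ℝ)⁻¹ *
        (d * ∑ i, agreementSign (x i) (D (M x) i))) ≤
      ∑ x : Fin n → Bool, (2 ^ n : ℝ)⁻¹ *
        Real.exp (d * ∑ i, agreementSign (x i) (D (M x) i)) := by
    have := convexOn_exp.map_sum_le (t := (Finset.univ : Finset (Fin n → Bool)))
      (w := fun _ => (2 ^ n : ℝ)⁻¹)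
      (p := fun x => d * ∑ i, agreementSign (x i) (D (M x) i))
      (fun _ _ => by positivity) (by simp) (fun _ _ => Set.mem_univ _)
    simpa using this
  have hlow : d ^ 2 * n ≤ ∑ x : Fin n → Bool, (2 ^ n : ℝ)⁻¹ *
      (d * ∑ i, agreementSign (x i) (D (M x) i)) := by
    rw [← Finset.mul_sum, ← Finset.mul_sum, inv_mul_eq_div, le_div_iff₀ hN]
    calc d ^ 2 * n * 2 ^ n = d * (d * (2 ^ n * n)) := by ring
      _ ≤ _ := mul_le_mul_of_nonneg_left h hd
  -- Replacing the actual message by a sum over all messages costs a factor `2 ^ s` but leaves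
  -- guesses that do not depend on `x`.
  have hup : ∑ x : Fin n → Bool, Real.exp (d * ∑ i, agreementSign (x i) (D (M x) i)) ≤
      2 ^ s * (2 ^ n * Real.cosh d ^ n) := by
    calc _ ≤ ∑ x : Fin n → Bool, ∑ σ : Fin s → Bool,
          Real.exp (d * ∑ i, agreementSign (x i) (D σ i)) :=
          Finset.sum_le_sum fun x _ => Finset.single_le_sum
            (f := fun σ => Real.exp (d * ∑ i, agreementSign (x i) (D σ i)))
            (fun _ _ => (Real.exp_pos _).le) (Finset.mem_univ (M x))
      _ = ∑ σ : Fin s → Bool, 2 ^ n * Real.cosh d ^ n := by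
          rw [Finset.sum_comm]
          exact Finset.sum_congr rfl fun σ _ => sum_exp_agreement d (D σ)
      _ = _ := by simp
  have hexp : Real.exp (d ^ 2 * n) ≤ Real.exp (s + d ^ 2 / 2 * n) := by
    calc Real.exp (d ^ 2 * n)
        ≤ ∑ x : Fin n → Bool, (2 ^ n : ℝ)⁻¹ *
            Real.exp (d * ∑ i, agreementSign (x i) (D (M x) i)) :=
          (Real.exp_le_exp.2 hlow).trans jensen
      _ ≤ (2 ^ n : ℝ)⁻¹ * (2 ^ s * (2 ^ n * Real.cosh d ^ n)) := by
          rw [← Finset.mul_sum]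
          gcongr
      _ = 2 ^ s * Real.cosh d ^ n := by field_simp
      -- With exponent parameter equal to the advantage `d`, Jensen's `d ^ 2 * n` loses only half to
      -- the `cosh` bound.
      _ ≤ Real.exp 1 ^ s * Real.exp (d ^ 2 / 2) ^ n := by
          have h2 : (2 : ℝ) ≤ Real.exp 1 := by linarith [Real.add_one_le_exp (1 : ℝ)]
          have := (Real.cosh_pos d).le
          gcongr
          exact Real.cosh_le_exp_half_sq d
      _ = Real.exp (s + d ^ 2 / 2 * n) := by
          rw [← Real.exp_nat_mul, ← Real.exp_nat_mul, ← Real.exp_add]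
          ring_nf
  linarith [Real.exp_le_exp.1 hexp]

/-! ### Optimal value on `m + 2` points -/

section MedianOpt

variable {V : Type*} [MetricSpace V]

theorem medianCost_nonneg (X C : Finset V) : 0 ≤ medianCost X C :=
  Finset.sum_nonneg fun _ _ => Metric.infDist_nonneg

theorem outlierCost_nonneg (m : ℕ) (X C : Finset V) : 0 ≤ outlierCost m X C :=
  Real.iInf_nonneg fun _ => medianCost_nonneg _ _

theorem le_medianOpt_one [Nonempty V] {m : ℕ} {X : Finset V} (hX : X.card = m + 2) {r : ℝ}
    (hr : ∀ a ∈ X, ∀ b ∈ X, a ≠ b → r ≤ dist a b) : r ≤ medianOpt 1 m X := by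
  classical
  obtain ⟨v⟩ := ‹Nonempty V›
  have : Nonempty {C : Finset V // C.card = 1} := ⟨⟨{v}, by simp⟩⟩
  have : Nonempty {Y : Finset V // Y ∈ X.powersetCard m} := by
    obtain ⟨Y, hY⟩ := Finset.powersetCard_nonempty.2 (show m ≤ X.card by omega)
    exact ⟨⟨Y, hY⟩⟩
  refine le_ciInf fun ⟨C, hC⟩ => le_ciInf fun ⟨Y, hY⟩ => ?_
  obtain ⟨c, rfl⟩ := Finset.card_eq_one.1 hC
  obtain ⟨hYX, hYm⟩ := Finset.mem_powersetCard.1 hY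
  have hcard : (X \ Y).card = 2 := by
    rw [Finset.card_sdiff_of_subset hYX]
    omega
  obtain ⟨a, b, hab, hXY⟩ := Finset.card_eq_two.1 hcard
  have ha : a ∈ X \ Y := by simp [hXY]
  have hb : b ∈ X \ Y := by simp [hXY]
  have hcost : medianCost (X \ Y) {c} = dist a c + dist b c := by
    rw [hXY, medianCost, Finset.sum_pair hab]
    simp
  calc r ≤ dist a b := hr a (Finset.mem_sdiff.1 ha).1 b (Finset.mem_sdiff.1 hb).1 hab
    _ ≤ dist a c + dist b c := dist_triangle_right a b c
    _ = medianCost (X \ Y) {c} := hcost.symm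
    _ ≤ _ := le_of_eq (by congr!)

theorem medianOpt_one_le {m : ℕ} {X : Finset V} (hX : X.card = m + 2) {a b : V}
    (ha : a ∈ X) (hb : b ∈ X) (hab : a ≠ b) : medianOpt 1 m X ≤ dist a b := by
  classical
  have hsub : ({a, b} : Finset V) ⊆ X := by
    simp [Finset.insert_subset_iff, ha, hb]
  have hY : X \ {a, b} ∈ X.powersetCard m := by
    rw [Finset.mem_powersetCard]
    refine ⟨Finset.sdiff_subset, ?_⟩
    rw [Finset.card_sdiff_of_subset hsub, Finset.card_pair hab]
    omega
  have hcost : medianCost (X \ (X \ {a, b})) {b} = dist a b := by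
    rw [Finset.sdiff_sdiff_eq_self hsub, medianCost, Finset.sum_pair hab]
    simp
  calc medianOpt 1 m X ≤ outlierCost m X {b} :=
        ciInf_le ⟨0, by rintro _ ⟨C, rfl⟩; exact outlierCost_nonneg _ _ _⟩
          (⟨{b}, by simp⟩ : {C : Finset V // C.card = 1})
    _ ≤ medianCost (X \ (X \ {a, b})) {b} := by
        refine (ciInf_le ⟨0, by rintro _ ⟨C, rfl⟩; exact medianCost_nonneg _ _⟩
          (⟨_, hY⟩ : {Y : Finset V // Y ∈ X.powersetCard m})).trans (le_of_eq ?_)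
        congr!
    _ = dist a b := hcost

end MedianOpt

/-! ### Measurability and composition of streaming algorithms -/

/-- Memory states are finitely many, so measurability of each step at fixed states passes to the
random state. -/
theorem Measurable.eval_countable {Ω ι β : Type*} [MeasurableSpace Ω] [MeasurableSpace ι]
    [MeasurableSpace β] [Countable ι] [MeasurableSingletonClass ι] {f : Ω → ι → β}
    (hf : ∀ i, Measurable fun ω => f ω i) {g : Ω → ι} (hg : Measurable g) :
    Measurable fun ω => f ω (g ω) :=
  (measurable_from_prod_countable_left (f := fun q : Ω × ι => f q.1 q.2) hf).comp
    (measurable_id.prodMk hg)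

namespace StreamingAlgorithm

variable {T : Type} (A : StreamingAlgorithm.{u} T)

theorem measurable_stateFrom (L : List T) (t : ℕ) (σ : A.Ω → Fin A.space → Bool)
    (hσ : Measurable[A.mΩ] σ) : Measurable[A.mΩ] fun ω => A.stateFrom ω t (σ ω) L := by
  let := A.mΩ
  induction L generalizing t σ with
  | nil => exact hσ
  | cons x L ih =>
    exact ih (t + 1) _ (Measurable.eval_countable (fun τ => A.measurable_step t τ x) hσ)

theorem measurable_answer (L : List T) : Measurable[A.mΩ] (A.answer L) := by
  let := A.mΩ
  exact Measurable.eval_countable (fun τ => A.measurable_output L.length τ)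
    (A.measurable_stateFrom L 0 _ A.measurable_init)

theorem stateFrom_concat (ω : A.Ω) (L : List T) (x : T) (t : ℕ) (σ : Fin A.space → Bool) :
    A.stateFrom ω t σ (L ++ [x]) = A.step ω (t + L.length) (A.stateFrom ω t σ L) x := by
  induction L generalizing t σ with
  | nil => rfl
  | cons y L ih =>
    simp only [List.cons_append, stateFrom, ih, List.length_cons]
    congr 1
    omega

/-- Space lower bound by reduction from the index problem: the first part of the stream encodes a
bit string `x`, one further insertion selects an index `i`, and the answer reveals `x i`. -/
theorem index_le_space {n : ℕ} {p : ℝ} (hp : 1 / 2 ≤ p) (E : (Fin n → Bool) → List T)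
    (hE : ∀ x, (E x).length = n) (q : Fin n → T) (S : Set ℝ) (P : (Fin n → Bool) → Fin n → ℝ → Prop)
    (hPm : ∀ x i, MeasurableSet {g | P x i g}) (hPS : ∀ x i g, P x i g → (x i = true ↔ g ∈ S))
    (hA : ∀ x i, p ≤ A.probAnswer (E x ++ [q i]) (P x i)) :
    (2 * p - 1) ^ 2 / 2 * n ≤ A.space := by
  classical
  let := A.mΩ
  have := A.isProbabilityMeasure
  let G (x : Fin n → Bool) (i : Fin n) : Set A.Ω := {ω | P x i (A.answer (E x ++ [q i]) ω)}
  have hG (x i) : MeasurableSet (G x i) := A.measurable_answer _ (hPm x i)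
  have hint (x i) : Integrable ((G x i).indicator (1 : A.Ω → ℝ)) A.law :=
    (integrable_const (1 : ℝ)).indicator (hG x i)
  -- Averaging fixes coins `ω` for which at least a fraction `p` of all pairs `(x, i)` succeed.
  obtain ⟨ω, hω⟩ := exists_integral_le (μ := A.law)
    (f := fun ω => ∑ x, ∑ i, (G x i).indicator (1 : A.Ω → ℝ) ω)
    (integrable_finsetSum _ fun x _ => integrable_finsetSum _ fun i _ => hint x i)
  have hsum : p * (2 ^ n * n) ≤ ∑ x, ∑ i, (G x i).indicator (1 : A.Ω → ℝ) ω := by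
    refine le_trans ?_ hω
    rw [integral_finsetSum _ fun x _ => integrable_finsetSum _ fun i _ => hint x i]
    calc p * (2 ^ n * n) = ∑ _x : Fin n → Bool, ∑ _i : Fin n, p := by
          simp
          ring
      _ ≤ _ := by
          refine Finset.sum_le_sum fun x _ => ?_
          rw [integral_finsetSum _ fun i _ => hint x i]
          refine Finset.sum_le_sum fun i _ => ?_
          rw [integral_indicator_one (hG x i)]
          exact hA x i
  -- The decoder resumes from the message; it knows the clock because every encoding has length `n`.
  refine index_message_length (by linarith) (fun x => A.stateFrom ω 0 (A.init ω) (E x))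
    (fun σ i => decide (A.output ω (n + 1) (A.step ω n σ (q i)) ∈ S)) ?_
  have hterm (x : Fin n → Bool) (i : Fin n) :
      2 * (G x i).indicator (1 : A.Ω → ℝ) ω - 1 ≤ agreementSign (x i)
        (decide (A.output ω (n + 1)
          (A.step ω n (A.stateFrom ω 0 (A.init ω) (E x)) (q i)) ∈ S)) := by
    by_cases h : ω ∈ G x i
    · have hans : A.answer (E x ++ [q i]) ω = A.output ω (n + 1)
          (A.step ω n (A.stateFrom ω 0 (A.init ω) (E x)) (q i)) := by
        simp [answer, stateFrom_concat, hE]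
      have hiff := hPS x i _ h
      rw [hans] at hiff
      have : x i = decide (A.output ω (n + 1)
          (A.step ω n (A.stateFrom ω 0 (A.init ω) (E x)) (q i)) ∈ S) := by
        rw [Bool.eq_iff_iff, hiff, decide_eq_true_iff]
      rw [← this]
      simp [agreementSign, h]
      norm_num
    · rw [Set.indicator_of_notMem h, agreementSign]
      split_ifs <;> norm_num
  calc (2 * p - 1) * (2 ^ n * n)
      ≤ 2 * ∑ x, ∑ i, (G x i).indicator (1 : A.Ω → ℝ) ω - 2 ^ n * n := by linarith
    _ = ∑ x, ∑ i, (2 * (G x i).indicator (1 : A.Ω → ℝ) ω - 1) := by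
        simp [Finset.mul_sum, Finset.sum_sub_distrib]
    _ ≤ _ := Finset.sum_le_sum fun x _ => Finset.sum_le_sum fun i _ => hterm x i

end StreamingAlgorithm

/-! ### The hard instances -/

theorem measurableSet_isApproxValue (α v : ℝ) : MeasurableSet {g | IsApproxValue α v g} :=
  (measurableSet_Ioi (a := (0 : ℝ))).inter
    ((measurableSet_Ici (a := v / α)).inter (measurableSet_Iic (a := α * v)))

section Grid

variable {Δ : ℕ}

/-- The point of the planar grid with coordinates `a + 1` and `b + 1`. -/
def planarPoint (a b : ℕ) (ha : a < Δ) (hb : b < Δ) : GridPoint Δ 2 :=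
  ![⟨a + 1, by simp; omega⟩, ⟨b + 1, by simp; omega⟩]

theorem GridPoint.toEuclidean_injective {d : ℕ} :
    Function.Injective (GridPoint.toEuclidean : GridPoint Δ d → EuclideanSpace ℝ (Fin d)) := by
  intro x y h
  funext i
  have := congrArg (fun v : EuclideanSpace ℝ (Fin d) => v i) h
  simp only [GridPoint.toEuclidean] at this
  exact Subtype.ext (by exact_mod_cast this)

theorem GridPoint.abs_sub_le_dist {d : ℕ} (x y : GridPoint Δ d) (i : Fin d) :
    |((x i : ℕ) : ℝ) - ((y i : ℕ) : ℝ)| ≤ dist x.toEuclidean y.toEuclidean := by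
  rw [dist_eq_norm]
  simpa [GridPoint.toEuclidean] using
    PiLp.norm_apply_le (x.toEuclidean - y.toEuclidean) i

theorem card_streamDataset {d : ℕ} {L : List (GridPoint Δ d)} (hL : L.Nodup) :
    (streamDataset L).card = L.length := by
  classical
  have := List.toFinset_card_of_nodup (hL.map GridPoint.toEuclidean_injective)
  rw [List.length_map] at this
  rw [← this, streamDataset]

theorem mem_streamDataset {d : ℕ} {L : List (GridPoint Δ d)} {v : EuclideanSpace ℝ (Fin d)} :
    v ∈ streamDataset L ↔ ∃ x ∈ L, x.toEuclidean = v := by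
  simp [streamDataset]

theorem one_le_dist_toEuclidean {d : ℕ} {x y : GridPoint Δ d} (h : x ≠ y) :
    1 ≤ dist x.toEuclidean y.toEuclidean := by
  obtain ⟨i, hi⟩ := Function.ne_iff.1 h
  refine le_trans ?_ (GridPoint.abs_sub_le_dist x y i)
  have : ((x i : ℕ) : ℤ) - (y i : ℕ) ≠ 0 := by
    rw [sub_ne_zero]
    exact_mod_cast fun h' => hi (Subtype.ext h')
  exact_mod_cast Int.one_le_abs this

theorem le_dist_toEuclidean {d K : ℕ} {x y : GridPoint Δ d} (i : Fin d)
    (h : (x i : ℕ) + K ≤ y i ∨ (y i : ℕ) + K ≤ x i) :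
    (K : ℝ) ≤ dist x.toEuclidean y.toEuclidean := by
  refine le_trans ?_ (GridPoint.abs_sub_le_dist x y i)
  rcases h with h | h
  · rw [abs_sub_comm]
    refine le_trans ?_ (le_abs_self _)
    rw [le_sub_iff_add_le']
    exact_mod_cast h
  · refine le_trans ?_ (le_abs_self _)
    rw [le_sub_iff_add_le']
    exact_mod_cast h

theorem dist_planarPoint_succ {a b : ℕ} (ha : a < Δ) (hb : b + 1 < Δ) :
    dist (planarPoint a b ha (by omega)).toEuclidean
      (planarPoint a (b + 1) ha hb).toEuclidean = 1 := by
  rw [EuclideanSpace.dist_eq]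
  simp [GridPoint.toEuclidean, planarPoint, Real.dist_eq]

end Grid

section HardInstance

variable {Δ n K : ℕ}

theorem column_lt (hΔ : 2 * K * n + 1 < Δ) (j : Fin n) : 2 * K * j < Δ :=
  lt_of_le_of_lt (Nat.mul_le_mul_left _ j.2.le) (by omega)

theorem row_lt (hn : 0 < n) (hΔ : 2 * K * n + 1 < Δ) (b : Bool) :
    (if b then 2 * K else 0) < Δ := by
  have : 2 * K ≤ 2 * K * n := Nat.le_mul_of_pos_right _ hn
  split_ifs <;> omega

/-- The point that encodes bit `b` at index `j`: it lies in column `j`, at height `0` or `2K`. -/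
def codePoint (hn : 0 < n) (hΔ : 2 * K * n + 1 < Δ) (j : Fin n) (b : Bool) : GridPoint Δ 2 :=
  planarPoint (2 * K * j) (if b then 2 * K else 0) (column_lt hΔ j) (row_lt hn hΔ b)

/-- The stream that encodes a bit string. -/
def codeStream (hn : 0 < n) (hΔ : 2 * K * n + 1 < Δ) (x : Fin n → Bool) : List (GridPoint Δ 2) :=
  List.ofFn fun j => codePoint hn hΔ j (x j)

/-- The point in column `i` at distance `1` from the encoding of `false`. -/
def queryPoint (hΔ : 2 * K * n + 1 < Δ) (i : Fin n) : GridPoint Δ 2 :=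
  planarPoint (2 * K * i) (0 + 1) (column_lt hΔ i) (by omega)

theorem columns_separated (K : ℕ) {j k : Fin n} (h : j ≠ k) :
    2 * K * j + 1 + 2 * K ≤ 2 * K * k + 1 ∨ 2 * K * k + 1 + 2 * K ≤ 2 * K * j + 1 := by
  rcases lt_or_gt_of_ne h with h | h
  · left
    have := Nat.mul_le_mul_left (2 * K) (Nat.succ_le_of_lt (Fin.lt_def.1 h))
    rw [Nat.mul_succ] at this
    omega
  · right
    have := Nat.mul_le_mul_left (2 * K) (Nat.succ_le_of_lt (Fin.lt_def.1 h))
    rw [Nat.mul_succ] at this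
    omega

theorem le_dist_codePoint (hn : 0 < n) (hΔ : 2 * K * n + 1 < Δ) {j k : Fin n} (h : j ≠ k)
    (b c : Bool) :
    (K : ℝ) ≤ dist (codePoint hn hΔ j b).toEuclidean (codePoint hn hΔ k c).toEuclidean := by
  refine le_dist_toEuclidean 0 ?_
  have := columns_separated K h
  simp only [codePoint, planarPoint, Matrix.cons_val_zero]
  omega

/-- Different columns are at least `2 * K` apart; in the same column the heights `2 * K` and 1
differ by `2 * K - 1`, which is at least `K`. -/
theorem le_dist_codePoint_queryPoint (hn : 0 < n) (hK : 1 ≤ K) (hΔ : 2 * K * n + 1 < Δ)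
    {j i : Fin n} {b : Bool} (h : j ≠ i ∨ b = true) :
    (K : ℝ) ≤ dist (codePoint hn hΔ j b).toEuclidean (queryPoint hΔ i).toEuclidean := by
  rcases h with h | rfl
  · refine le_dist_toEuclidean 0 ?_
    have := columns_separated K h
    simp only [codePoint, queryPoint, planarPoint, Matrix.cons_val_zero]
    omega
  · refine le_dist_toEuclidean 1 ?_
    simp only [codePoint, queryPoint, planarPoint, Matrix.cons_val_one, if_true]
    simp
    omega

theorem dist_codePoint_false_queryPoint (hn : 0 < n) (hΔ : 2 * K * n + 1 < Δ) (i : Fin n) :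
    dist (codePoint hn hΔ i false).toEuclidean (queryPoint hΔ i).toEuclidean = 1 :=
  dist_planarPoint_succ (column_lt hΔ i) _

/-- Parity: code heights 0 and `2 * K` are even, the query height is 1. -/
theorem codePoint_ne_queryPoint (hn : 0 < n) (hΔ : 2 * K * n + 1 < Δ) (j i : Fin n)
    (b : Bool) : codePoint hn hΔ j b ≠ queryPoint hΔ i := by
  intro h
  have := congrArg (fun y : GridPoint Δ 2 => (y 1 : ℕ)) h
  simp [codePoint, queryPoint, planarPoint] at this
  split_ifs at this
  omega

theorem nodup_codeStream_query (hn : 0 < n) (hK : 1 ≤ K) (hΔ : 2 * K * n + 1 < Δ)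
    (x : Fin n → Bool) (i : Fin n) : (codeStream hn hΔ x ++ [queryPoint hΔ i]).Nodup := by
  rw [List.nodup_append]
  refine ⟨List.nodup_ofFn.2 fun j k hjk => ?_, List.nodup_singleton _, ?_⟩
  · by_contra hne
    have := le_dist_codePoint hn hΔ hne (x j) (x k)
    rw [hjk, dist_self] at this
    have hK' : (1 : ℝ) ≤ K := by exact_mod_cast hK
    linarith
  · intro a ha c hc
    obtain ⟨j, rfl⟩ := List.mem_ofFn.1 ha
    rw [List.mem_singleton.1 hc]
    exact codePoint_ne_queryPoint hn hΔ j i (x j)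

variable {m : ℕ}

theorem card_codeStream_query (hΔ : 2 * K * (m + 1) + 1 < Δ) (hK : 1 ≤ K)
    (x : Fin (m + 1) → Bool) (i : Fin (m + 1)) :
    (streamDataset (codeStream m.succ_pos hΔ x ++ [queryPoint hΔ i])).card = m + 2 := by
  rw [card_streamDataset (nodup_codeStream_query m.succ_pos hK hΔ x i)]
  simp [codeStream]

/-- Ensures a positive optimum on every hard instance, so that the guarantee of the algorithm
applies. -/
theorem one_le_medianOpt_codeStream (hΔ : 2 * K * (m + 1) + 1 < Δ) (hK : 1 ≤ K)
    (x : Fin (m + 1) → Bool) (i : Fin (m + 1)) :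
    1 ≤ medianOpt 1 m (streamDataset (codeStream m.succ_pos hΔ x ++ [queryPoint hΔ i])) := by
  refine le_medianOpt_one (card_codeStream_query hΔ hK x i) fun a ha b hb hab => ?_
  obtain ⟨y, -, rfl⟩ := mem_streamDataset.1 ha
  obtain ⟨z, -, rfl⟩ := mem_streamDataset.1 hb
  exact one_le_dist_toEuclidean fun h => hab (by rw [h])

theorem medianOpt_codeStream_le_one (hΔ : 2 * K * (m + 1) + 1 < Δ) (hK : 1 ≤ K)
    {x : Fin (m + 1) → Bool} {i : Fin (m + 1)} (hx : x i = false) :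
    medianOpt 1 m (streamDataset (codeStream m.succ_pos hΔ x ++ [queryPoint hΔ i])) ≤ 1 := by
  rw [← dist_codePoint_false_queryPoint m.succ_pos hΔ i]
  refine medianOpt_one_le (card_codeStream_query hΔ hK x i)
    (mem_streamDataset.2 ⟨_, ?_, rfl⟩) (mem_streamDataset.2 ⟨_, ?_, rfl⟩) ?_
  · rw [← hx]
    exact List.mem_append_left _ (List.mem_ofFn.2 ⟨i, rfl⟩)
  · simp
  · exact fun h => codePoint_ne_queryPoint m.succ_pos hΔ i i false
      (GridPoint.toEuclidean_injective h)

theorem le_medianOpt_codeStream (hΔ : 2 * K * (m + 1) + 1 < Δ) (hK : 1 ≤ K)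
    {x : Fin (m + 1) → Bool} {i : Fin (m + 1)} (hx : x i = true) :
    (K : ℝ) ≤
      medianOpt 1 m (streamDataset (codeStream m.succ_pos hΔ x ++ [queryPoint hΔ i])) := by
  have hquery (j : Fin (m + 1)) : (K : ℝ) ≤
      dist (codePoint m.succ_pos hΔ j (x j)).toEuclidean (queryPoint hΔ i).toEuclidean := by
    refine le_dist_codePoint_queryPoint m.succ_pos hK hΔ ?_
    by_cases h : j = i
    · exact Or.inr (h ▸ hx)
    · exact Or.inl h
  refine le_medianOpt_one (card_codeStream_query hΔ hK x i) fun a ha b hb hab => ?_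
  obtain ⟨y, hy, rfl⟩ := mem_streamDataset.1 ha
  obtain ⟨z, hz, rfl⟩ := mem_streamDataset.1 hb
  rw [List.mem_append, List.mem_singleton, codeStream, List.mem_ofFn] at hy hz
  rcases hy with ⟨j, rfl⟩ | rfl <;> rcases hz with ⟨k, rfl⟩ | rfl
  · exact le_dist_codePoint m.succ_pos hΔ (fun h => hab (by rw [h])) _ _
  · exact hquery j
  · rw [dist_comm]
    exact hquery k
  · exact absurd rfl hab

end HardInstance

theorem claimD1 (p : ℝ) (hp : 1 / 2 < p) (hp1 : p ≤ 1) :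
    ∃ c : ℝ, 0 < c ∧
      ∀ m : ℕ, 10 ≤ m →
        ∀ A : StreamingAlgorithm.{u} (GridPoint (2 * m ^ 10) 2),
          A.ApproximatesMedian 1 m (m : ℝ) p → c * (m : ℝ) ≤ (A.space : ℝ) := by
  have hd : 0 < 2 * p - 1 := by linarith
  refine ⟨(2 * p - 1) ^ 2 / 2, by positivity, fun m hm A hA => ?_⟩
  -- `K = m ^ 3` makes `K / m = m ^ 2` exceed `m`, while the columns still fit in the grid.
  have hK : 1 ≤ m ^ 3 := Nat.one_le_pow _ _ (by omega)
  have hΔ : 2 * m ^ 3 * (m + 1) + 1 < 2 * m ^ 10 := by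
    calc 2 * m ^ 3 * (m + 1) + 1 < 2 * m ^ 3 * (m + 1) + 2 * m ^ 3 := by omega
      _ = 2 * m ^ 3 * (m + 2) := by ring
      _ ≤ 2 * m ^ 3 * (m * m) := Nat.mul_le_mul_left _ (by nlinarith)
      _ = 2 * m ^ 5 := by ring
      _ ≤ 2 * m ^ 10 := Nat.mul_le_mul_left _ (Nat.pow_le_pow_right (by omega) (by norm_num))
  have hm1 : (1 : ℝ) < m := by exact_mod_cast (by omega : 1 < m)
  have hm0 : (0 : ℝ) < m := by linarith
  have key := A.index_le_space hp.le (codeStream m.succ_pos hΔ) (fun x => by simp [codeStream])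
    -- Correct answers are at most `m` for a `false` bit and at least `m ^ 2` for a `true` one.
    (queryPoint hΔ) (Set.Ioi (m : ℝ))
    (fun x i => IsApproxValue m
      (medianOpt 1 m (streamDataset (codeStream m.succ_pos hΔ x ++ [queryPoint hΔ i]))))
    (fun x i => measurableSet_isApproxValue _ _)
    (fun x i g ⟨_, hlow, hup⟩ => by
      rw [Set.mem_Ioi]
      constructor
      · intro hx
        have h := le_medianOpt_codeStream hΔ hK hx
        rw [div_le_iff₀ hm0] at hlow
        push_cast at h
        have h2 : (m : ℝ) ^ 2 * m ≤ g * m := by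
          calc (m : ℝ) ^ 2 * m = (m : ℝ) ^ 3 := by ring
            _ ≤ g * m := h.trans hlow
        have h3 := le_of_mul_le_mul_right h2 hm0
        nlinarith
      · intro hg
        by_contra hx
        have h := medianOpt_codeStream_le_one hΔ hK (Bool.eq_false_iff.2 hx)
        nlinarith)
    (fun x i => hA _ (nodup_codeStream_query m.succ_pos hK hΔ x i)
      (zero_lt_one.trans_le (one_le_medianOpt_codeStream hΔ hK x i)))
  refine le_trans ?_ key
  push_cast
  gcongr
  linarith
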